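/- Let $\Sigma\subset i\mathfrak t^*$ be the root system of a compact simply connected simple Lie group with Cartan subalgebra $\mathfrak t$ (an irreducible reduced crystallographic root system of rank $r=\dim\mathfrak t$, consisting of linear forms on $\mathfrak t$ with imaginary values). Let $\Sigma^+$ be a positive system with simple roots $\alpha_1,\dots,\alpha_r$, let $-\alpha_0$ be the highest root, and put $t_j(H)=\alpha_j(H)/2\pi i+\delta_{0j}$ for $0\le j\le r$, where $\delta_{0j}$ is the Kronecker delta. Let $A=\{H\in\mathfrak t: t_j(H)>0\ \text{for all } j\}$ be the open fundamental alcove, and for $J\subsetneq\{0,\dots,r\}$ let $A_J=\{H: t_j(H)=0\ \text{for } j\in J,\ t_j(H)>0\ \text{for } j\notin J\}$ be the facets of its closure. Let $\Sigma_J$ be the root subsystem with simple roots $\alpha_j$, $j\in J$, and let $\Sigma_J^+$ be its positive system, i.e. the set of roots of $\Sigma$ that are combinations of the $\alpha_j$, $j\in J$, with nonnegative integer coefficients. Let $I\subset\{0,\dots,r\}$ with $|I|=r$ and let $J\subset I$. Let $C_I$ be the convex hull of the barycenters (means of the vertices) of the facets $A_K$, $K\subset I$. For $N\ge1$ put $$P_{I,J}=\{H\in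 A\cap C_I:\ t_j(H)\le N^{-1}\ \text{for } j\in J,\ t_j(H)>N^{-1}\ \text{for } j\notin J\},$$ $$\delta_{I,J}(H)=\prod_{\alpha\in\Sigma_I^+\setminus\Sigma_J^+}\left(e^{\alpha(H)/2}-e^{-\alpha(H)/2}\right).$$ Fix a Haar (Lebesgue) measure on $\mathfrak t$ and let $0<p\le\infty$, with $r/p=0$ when $p=\infty$. Then, for all $N\ge1$, $$\left\|\frac1{\delta_{I,J}}\right\|_{L^p(P_{I,J})}\le\begin{cases} C\,N^{|\Sigma^+|-|\Sigma_J^+|-r/p}, & p>\frac r{|\Sigma^+|},\\ C_\varepsilon\,N^{-|\Sigma_J^+|+\varepsilon}\ \text{ for every } \varepsilon>0, & p=\frac r{|\Sigma^+|},\\ C\,N^{-|\Sigma_J^+|}, & p<\frac r{|\Sigma^+|},\end{cases}$$ where the constant $C$ does not depend on $N$ and $C_\varepsilon$ depends on $\varepsilon$ but not on $N$. -/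

import Mathlib

open scoped ENNReal

/-! The real vector space `𝔱` is the Cartan subalgebra and `M` is its dual, through the perfect
pairing of the root pairing `P`. The imaginary-valued roots `α ∈ i𝔱*` are `α = i a`, where `a` runs
over the roots `P.root k`. The set of nodes `{0, 1, …, r}` of the extended Dynkin diagram is
`Option b.support`: the node `0` is `none`, the other nodes are the simple roots. -/

namespace WeylAlcove

variable {ι M 𝔱 : Type*} [AddCommGroup M] [Module ℝ M] [AddCommGroup 𝔱] [Module ℝ 𝔱]
  {P : RootPairing ι ℝ M 𝔱}

/-- `θ` is the highest root with respect to the base `b`: for every root `β`, the difference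
`θ - β` is a sum of simple roots. -/
def IsHighestRoot (b : P.Base) (θ : ι) : Prop :=
  ∀ k : ι, P.root θ - P.root k ∈ AddSubmonoid.closure (P.root '' (b.support : Set ι))

/-- The roots `α₀, α₁, …, α_r`: the lowest root `α₀ = -θ` and the simple roots. -/
def extRoot (b : P.Base) (θ : ι) : Option b.support → M
  | none => -P.root θ
  | some j => P.root j

/-- The value `α(H) = i a(H)` of the imaginary-valued root `α = i a`. -/
noncomputable def rootValue (P : RootPairing ι ℝ M 𝔱) (k : ι) (H : 𝔱) : ℂ :=
  Complex.I * (P.toLinearMap (P.root k) H : ℂ)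

/-- The affine coordinates `t_j(H) = α_j(H) / (2πi) + δ_{0j}`. -/
noncomputable def wallCoord (b : P.Base) (θ : ι) (j : Option b.support) (H : 𝔱) : ℝ :=
  P.toLinearMap (extRoot b θ j) H / (2 * Real.pi) + (if j = none then 1 else 0)

/-- The open fundamental alcove `A`. -/
def alcove (b : P.Base) (θ : ι) : Set 𝔱 :=
  {H | ∀ j, 0 < wallCoord b θ j H}

/-- The facet `A_J` of the closed alcove. -/
def facet (b : P.Base) (θ : ι) (J : Finset (Option b.support)) : Set 𝔱 :=
  {H | (∀ j ∈ J, wallCoord b θ j H = 0) ∧ ∀ j ∉ J, 0 < wallCoord b θ j H}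

open Classical in
/-- `x` is the barycenter of the facet `A_J` (`J` proper): the mean of the vertices of `A_J`. Here
`v k` is the vertex of the alcove opposite to the wall `t_k = 0`, that is, the unique point of the
facet of all nodes but `k`; it is a vertex of `A_J` exactly when `k ∉ J`. -/
def IsFacetBarycenter (b : P.Base) (θ : ι) (J : Finset (Option b.support)) (x : 𝔱) : Prop :=
  ∃ v : Option b.support → 𝔱,
    (∀ k, v k ∈ facet b θ (Finset.univ.erase k)) ∧ x = Finset.centroid ℝ Jᶜ v

/-- The barycentric piece `C_I`: the convex hull of the barycenters of the facets `A_J`, `J ⊆ I`. -/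
def baryPiece (b : P.Base) (θ : ι) (I : Finset (Option b.support)) : Set 𝔱 :=
  convexHull ℝ {x | ∃ J ⊆ I, IsFacetBarycenter b θ J x}

/-- The semiclassical piece `P_J` at scale `N⁻¹`. -/
def semiPiece (b : P.Base) (θ : ι) (N : ℝ) (J : Finset (Option b.support)) : Set 𝔱 :=
  {H | H ∈ alcove b θ ∧ (∀ j ∈ J, wallCoord b θ j H ≤ N⁻¹) ∧ ∀ j ∉ J, N⁻¹ < wallCoord b θ j H}

/-- The barycentric-semiclassical piece `P_{I,J} = P_J ∩ C_I`. -/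
def piece (b : P.Base) (θ : ι) (N : ℝ) (I J : Finset (Option b.support)) : Set 𝔱 :=
  semiPiece b θ N J ∩ baryPiece b θ I

open Classical in
/-- The positive system `Σ⁺` of the base `b`. -/
noncomputable def posRoots [Fintype ι] (b : P.Base) : Finset ι :=
  {k | P.root k ∈ AddSubmonoid.closure (P.root '' (b.support : Set ι))}

open Classical in
/-- The positive system `Σ_J⁺` (with simple roots `α_j`, `j ∈ J`) of the root subsystem `Σ_J`: the
roots that are sums of roots `α_j`, `j ∈ J`. -/
noncomputable def subPosRoots [Fintype ι] (b : P.Base) (θ : ι) (J : Finset (Option b.support)) :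
    Finset ι :=
  {k | P.root k ∈ AddSubmonoid.closure (extRoot b θ '' (J : Set (Option b.support)))}

open Classical in
/-- The weight function `δ_{I,J}`. -/
noncomputable def weight [Fintype ι] (b : P.Base) (θ : ι) (I J : Finset (Option b.support))
    (H : 𝔱) : ℂ :=
  ∏ k ∈ subPosRoots b θ I \ subPosRoots b θ J,
    (Complex.exp (rootValue P k H / 2) - Complex.exp (-(rootValue P k H / 2)))

/-- The `L^p` (quasi)norm of `1 / δ_{I,J}` on `P_{I,J}`, at scale `N⁻¹`. -/
noncomputable def invWeightNorm [Fintype ι] [MeasurableSpace 𝔱] (b : P.Base) (θ : ι)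
    (μ : MeasureTheory.Measure 𝔱) (p : ℝ≥0∞) (N : ℝ) (I J : Finset (Option b.support)) : ℝ≥0∞ :=
  MeasureTheory.eLpNorm (fun H => 1 / weight b θ I J H) p (μ.restrict (piece b θ N I J))

end WeylAlcove

/-!
Write `r` for the rank. The operator `∑ (1 - s_α)` over all roots commutes with the Weyl group, so
it is a scalar, and comparing its trace with the trace of its compression to a `d`-dimensional
subspace shows that such a subspace contains at most `d |Σ| / r` roots. Hence
`|Σ_K⁺| ≤ |K| |Σ⁺| / r`.

On `P_{I,J}`, a factor of `δ_{I,J}` at a root outside `Σ_K⁺` dominates some `t_j` with `j ∉ K`.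
Applying the count to `K = {j ∈ I | t_j < u}` at every scale `u` (a layer cake argument) gives
`1 / |δ_{I,J}| ≤ C N ^ (-|Σ_J⁺|) ∏_{j ∈ I} max(t_j, N⁻¹) ^ (-|Σ⁺| / r)`.

The `t_j`, `j ∈ I`, are affine coordinates on `𝔱`, so the `L^p` norm of the right-hand side is at
most a constant times the product of `r` copies of the `L^p` norm of `max(x, N⁻¹) ^ (-|Σ⁺| / r)` on
`(0, 1]`, whose three regimes are the three cases of the theorem.
-/

namespace WeylAlcove

/-! ### The density of roots in a subspace -/

section RootDensity

variable {ι N : Type*} [Fintype ι] [AddCommGroup N] [Module ℝ N]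

section

variable {M : Type*} [AddCommGroup M] [Module ℝ M]

/-- The sum `∑ (1 - s_α)` over all roots `α`, where `s_α` is the reflection in `α`. It commutes with
the Weyl group, so it is a scalar when the root pairing is irreducible. -/
noncomputable def sumOneSubReflection (P : RootPairing ι ℝ M N) : M →ₗ[ℝ] M :=
  ∑ i, (P.coroot' i).smulRight (P.root i)

lemma sumOneSubReflection_apply (P : RootPairing ι ℝ M N) (x : M) :
    sumOneSubReflection P x = ∑ i, P.coroot' i x • P.root i := by
  simp [sumOneSubReflection]

lemma sumOneSubReflection_reflection (P : RootPairing ι ℝ M N) (j : ι) (x : M) :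
    sumOneSubReflection P (P.reflection j x) = P.reflection j (sumOneSubReflection P x) := by
  have coroot'_perm (i : ι) :
      P.coroot' (P.reflectionPerm j i) (P.reflection j x) = P.coroot' i x := by
    simp only [RootPairing.coroot', P.coroot_reflectionPerm, RootPairing.coreflection_apply,
      RootPairing.root_coroot_eq_pairing, map_sub, map_smul, RootPairing.reflection_apply,
      LinearMap.flip_apply, LinearMap.sub_apply, LinearMap.smul_apply, smul_eq_mul,
      RootPairing.pairing_same]
    ring
  rw [sumOneSubReflection_apply, sumOneSubReflection_apply, map_sum,
    ← Equiv.sum_comp (P.reflectionPerm j)]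
  exact Finset.sum_congr rfl fun i _ => by
    rw [coroot'_perm, map_smul, P.root_reflectionPerm]

end

section Inner

open scoped InnerProductSpace

variable {E : Type*} [NormedAddCommGroup E] [InnerProductSpace ℝ E] {P : RootPairing ι ℝ E N}
  (hP : ∀ i x y, ⟪P.reflection i x, P.reflection i y⟫_ℝ = ⟪x, y⟫_ℝ)
include hP

omit [Fintype ι] in
lemma two_mul_inner_root (i : ι) (y : E) :
    2 * ⟪P.root i, y⟫_ℝ = P.coroot' i y * ⟪P.root i, P.root i⟫_ℝ := by
  have h := hP i (P.root i) y
  rw [P.reflection_apply_self, P.reflection_apply, inner_neg_left, inner_sub_right,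
    inner_smul_right] at h
  linarith

omit [Fintype ι] in
lemma coroot'_eq_div_mul_inner_root (i : ι) (y : E) :
    P.coroot' i y = 2 / ⟪P.root i, P.root i⟫_ℝ * ⟪P.root i, y⟫_ℝ := by
  have hpos : 0 < ⟪P.root i, P.root i⟫_ℝ := real_inner_self_pos.2 (P.ne_zero i)
  rw [div_mul_eq_mul_div, two_mul_inner_root hP, mul_div_cancel_right₀ _ hpos.ne']

lemma isSymmetric_sumOneSubReflection : (sumOneSubReflection P).IsSymmetric := by
  intro x y
  simp only [sumOneSubReflection_apply, sum_inner, inner_sum, real_inner_smul_left,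
    inner_smul_right, coroot'_eq_div_mul_inner_root hP, real_inner_comm x]
  exact Finset.sum_congr rfl fun i _ => by ring

variable [FiniteDimensional ℝ E]

lemma exists_sumOneSubReflection_eq_smul_id [P.IsIrreducible] :
    ∃ c : ℝ, sumOneSubReflection P = c • LinearMap.id := by
  have := RootPairing.IsIrreducible.nontrivial P
  have hsymm := isSymmetric_sumOneSubReflection hP
  obtain ⟨c, hc⟩ : ∃ c : ℝ, Module.End.HasEigenvalue (sumOneSubReflection P) c :=
    ⟨_, hsymm.hasEigenvalue_iSup_of_finiteDimensional⟩
  have htop : Module.End.eigenspace (sumOneSubReflection P) c = ⊤ := by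
    refine RootPairing.IsIrreducible.eq_top_of_invtSubmodule_reflection (P := P) _
      (fun j x hx => ?_) hc
    rw [Module.End.mem_eigenspace_iff] at hx
    rw [Submodule.mem_comap, Module.End.mem_eigenspace_iff, LinearEquiv.coe_coe,
      sumOneSubReflection_reflection, hx, map_smul]
  refine ⟨c, LinearMap.ext fun x => ?_⟩
  exact Module.End.mem_eigenspace_iff.1 (htop ▸ Submodule.mem_top : x ∈ _)

lemma exists_sum_coroot'_apply_root_eq_mul_trace [P.IsIrreducible] :
    ∃ c : ℝ, ∀ f : E →ₗ[ℝ] E, ∑ i, P.coroot' i (f (P.root i)) = c * LinearMap.trace ℝ E f := by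
  obtain ⟨c, hc⟩ := exists_sumOneSubReflection_eq_smul_id hP
  refine ⟨c, fun f => ?_⟩
  have hcomp : ∑ i, (P.coroot' i).smulRight (f (P.root i)) = c • f := by
    calc ∑ i, (P.coroot' i).smulRight (f (P.root i)) = f ∘ₗ sumOneSubReflection P := by
          ext x; simp [sumOneSubReflection_apply]
      _ = c • f := by ext x; simp [hc]
  simpa [LinearMap.trace_smulRight] using congrArg (LinearMap.trace ℝ E) hcomp

lemma two_mul_card_filter_root_mem_le (V : Submodule ℝ E) [DecidablePred (P.root · ∈ V)] :
    2 * (Finset.card {i | P.root i ∈ V} : ℝ)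
      ≤ ∑ i, P.coroot' i (V.starProjection (P.root i)) := by
  have nonneg (i : ι) : 0 ≤ P.coroot' i (V.starProjection (P.root i)) := by
    rw [coroot'_eq_div_mul_inner_root hP,
      ← V.isIdempotentElem_starProjection.eq, mul_apply_eq_comp,
      ← Submodule.inner_starProjection_left_eq_right]
    exact mul_nonneg (div_nonneg zero_le_two real_inner_self_nonneg) real_inner_self_nonneg
  calc 2 * (Finset.card {i | P.root i ∈ V} : ℝ)
      = ∑ i with P.root i ∈ V, P.coroot' i (V.starProjection (P.root i)) := by
        rw [mul_comm, ← nsmul_eq_mul]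
        refine (Finset.sum_eq_card_nsmul fun i hi => ?_).symm
        rw [Submodule.starProjection_eq_self_iff.2 (Finset.mem_filter.1 hi).2]
        exact P.root_coroot_two i
    _ ≤ ∑ i, P.coroot' i (V.starProjection (P.root i)) :=
        Finset.sum_le_sum_of_subset_of_nonneg (Finset.filter_subset _ _) fun i _ _ => nonneg i

lemma card_filter_root_mem_mul_finrank_le_of_inner [P.IsIrreducible] (V : Submodule ℝ E)
    [DecidablePred (P.root · ∈ V)] :
    Finset.card {i | P.root i ∈ V} * Module.finrank ℝ E
      ≤ Module.finrank ℝ V * Fintype.card ι := by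
  obtain ⟨c, hc⟩ := exists_sum_coroot'_apply_root_eq_mul_trace hP
  have card_eq : 2 * (Fintype.card ι : ℝ) = c * Module.finrank ℝ E := by
    simpa [LinearMap.trace_id, mul_comm] using hc LinearMap.id
  have trace_eq : LinearMap.trace ℝ E V.starProjection.toLinearMap = Module.finrank ℝ V :=
    LinearMap.IsProj.trace (p := V)
      ⟨fun x => by simp, fun x hx => Submodule.starProjection_eq_self_iff.2 hx⟩
  have card_le : 2 * (Finset.card {i | P.root i ∈ V} : ℝ) ≤ c * Module.finrank ℝ V := by
    rw [← trace_eq, ← hc]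
    exact two_mul_card_filter_root_mem_le hP V
  have : (Finset.card {i | P.root i ∈ V} * Module.finrank ℝ E : ℝ)
      ≤ Module.finrank ℝ V * Fintype.card ι := by
    have := mul_le_mul_of_nonneg_right card_le (Nat.cast_nonneg (α := ℝ) (Module.finrank ℝ E))
    linear_combination this / 2 - (Module.finrank ℝ V : ℝ) / 2 * card_eq
  exact_mod_cast this

end Inner

theorem card_filter_root_mem_mul_finrank_le {M : Type*} [AddCommGroup M] [Module ℝ M]
    (P : RootPairing ι ℝ M N) [P.IsRootSystem] [P.IsIrreducible] (V : Submodule ℝ M)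
    [DecidablePred (P.root · ∈ V)] :
    Finset.card {i | P.root i ∈ V} * Module.finrank ℝ M
      ≤ Module.finrank ℝ V * Fintype.card ι := by
  have hspan : P.rootSpan ℝ = ⊤ := RootPairing.IsRootSystem.span_root_eq_top
  have : Module.Finite ℝ M := ⟨hspan ▸ Submodule.fg_span (Set.finite_range _)⟩
  let core : InnerProductSpace.Core ℝ M :=
    { inner := fun x y => P.RootForm x y
      conj_inner_symm := fun x y => by simpa using P.rootForm_symmetric.eq y x
      re_inner_nonneg := fun x => by simpa using P.zero_le_rootForm x
      add_left := fun x y z => by simp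
      smul_left := fun x y r => by simp
      definite := fun x hx =>
        P.eq_zero_of_mem_rootSpan_of_rootForm_self_eq_zero (hspan ▸ Submodule.mem_top) hx }
  let := core.toNormedAddCommGroup
  let := InnerProductSpace.ofCore core.toCore
  exact card_filter_root_mem_mul_finrank_le_of_inner
    (fun i x y => P.rootForm_reflection_reflection_apply i x y) V

end RootDensity

/-! ### The extended Dynkin diagram -/

section ExtendedDiagram

variable {ι M 𝔱 : Type*} [AddCommGroup M] [Module ℝ M] [AddCommGroup 𝔱] [Module ℝ 𝔱]
  {P : RootPairing ι ℝ M 𝔱}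

lemma mem_closure_image_extRoot_iff {b : P.Base} {θ : ι} {K : Finset (Option b.support)} {x : M} :
    x ∈ AddSubmonoid.closure (extRoot b θ '' (K : Set (Option b.support))) ↔
      ∃ n : Option b.support → ℕ, (∀ j ∉ K, n j = 0) ∧ x = ∑ i, n i • extRoot b θ i := by
  classical
  constructor
  · intro hx
    induction hx using AddSubmonoid.closure_induction with
    | mem x hx =>
      obtain ⟨i, hi, rfl⟩ := hx
      refine ⟨Pi.single i 1, fun j hj => Pi.single_eq_of_ne (ne_of_mem_of_not_mem hi hj).symm _, ?_⟩
      simp [Pi.single_apply, ite_smul]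
    | zero => exact ⟨0, by simp⟩
    | add x y _ _ hx hy =>
      obtain ⟨n, hn, rfl⟩ := hx
      obtain ⟨n', hn', rfl⟩ := hy
      exact ⟨n + n', fun j hj => by simp [hn j hj, hn' j hj], by
        simp [add_smul, Finset.sum_add_distrib]⟩
  · rintro ⟨n, hn, rfl⟩
    refine sum_mem fun i _ => ?_
    by_cases hi : i ∈ K
    · exact nsmul_mem (AddSubmonoid.subset_closure (Set.mem_image_of_mem _ hi)) _
    · simp [hn i hi]

variable [P.IsRootSystem]

lemma finrank_eq_card_support (b : P.Base) : Module.finrank ℝ M = b.support.card := by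
  rw [Module.finrank_eq_card_basis b.toWeightBasis, Fintype.card_coe]

/-- The marks of the extended Dynkin diagram: `1` at the affine node, and the coefficients of the
root `θ` at the other nodes. -/
noncomputable def mark (b : P.Base) (θ : ι) : Option b.support → ℝ
  | none => 1
  | some j => b.toWeightBasis.repr (P.root θ) j

lemma repr_nonneg_of_mem_closure (b : P.Base) {x : M}
    (hx : x ∈ AddSubmonoid.closure (P.root '' (b.support : Set ι))) (j : b.support) :
    0 ≤ b.toWeightBasis.repr x j := by
  classical
  induction hx using AddSubmonoid.closure_induction with
  | mem x hx =>
    obtain ⟨i, hi, rfl⟩ := hx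
    rw [b.toWeightBasis_repr_root ⟨i, hi⟩, Finsupp.single_apply]
    split_ifs <;> norm_num
  | zero => simp
  | add x y _ _ hx hy => simpa using add_nonneg hx hy

lemma repr_root_nonpos_of_repr_root_neg (b : P.Base) {k : ι} {i : b.support}
    (hi : b.toWeightBasis.repr (P.root k) i < 0) (j : b.support) :
    b.toWeightBasis.repr (P.root k) j ≤ 0 := by
  rcases b.root_mem_or_neg_mem k with hk | hk
  · exact absurd (repr_nonneg_of_mem_closure b hk i) hi.not_ge
  · simpa using repr_nonneg_of_mem_closure b hk j

lemma repr_sum_smul_extRoot (b : P.Base) (θ : ι) (c : Option b.support → ℝ) (j : b.support) :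
    b.toWeightBasis.repr (∑ i, c i • extRoot b θ i) j
      = c (some j) - c none * mark b θ (some j) := by
  classical
  simp only [Fintype.sum_option, extRoot, mark, map_add, map_sum, map_smul, map_neg,
    b.toWeightBasis_repr_root, Finsupp.coe_add, Pi.add_apply, Finsupp.coe_smul, Pi.smul_apply,
    Finsupp.coe_neg, Pi.neg_apply, Finsupp.finsetSum_apply, Finsupp.single_apply, smul_eq_mul,
    mul_ite, mul_one, mul_zero, Finset.sum_ite_eq', Finset.mem_univ, if_true]
  ring

lemma sum_smul_extRoot_eq_zero_iff (b : P.Base) (θ : ι) {c : Option b.support → ℝ} :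
    ∑ i, c i • extRoot b θ i = 0 ↔ ∀ j, c j = c none * mark b θ j := by
  rw [← b.toWeightBasis.repr.map_eq_zero_iff, Finsupp.ext_iff, Option.forall]
  simp only [repr_sum_smul_extRoot, Finsupp.zero_apply, sub_eq_zero, mark, mul_one, true_and]

lemma sum_mark_smul_extRoot (b : P.Base) (θ : ι) : ∑ i, mark b θ i • extRoot b θ i = 0 :=
  (sum_smul_extRoot_eq_zero_iff b θ).2 fun _ => (one_mul _).symm

variable {b : P.Base} {θ : ι} (hθ : IsHighestRoot b θ)
include hθ

lemma repr_root_le_mark (k : ι) (j : b.support) :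
    b.toWeightBasis.repr (P.root k) j ≤ mark b θ (some j) := by
  simpa [mark] using repr_nonneg_of_mem_closure b (hθ k) j

lemma neg_mark_le_repr_root (k : ι) (j : b.support) :
    -mark b θ (some j) ≤ b.toWeightBasis.repr (P.root k) j := by
  have := repr_root_le_mark hθ (P.reflectionPerm k k) j
  rw [P.root_reflectionPerm, P.reflection_apply_self, map_neg, Finsupp.neg_apply] at this
  linarith

lemma one_le_mark : ∀ j, 1 ≤ mark b θ j
  | none => le_rfl
  | some j => by simpa using repr_root_le_mark hθ j j

lemma eq_zero_of_sum_smul_extRoot_eq_zero {c : Option b.support → ℝ}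
    (hc : ∑ i, c i • extRoot b θ i = 0) {i : Option b.support} (hi : c i = 0) : c = 0 := by
  have hmark := (sum_smul_extRoot_eq_zero_iff b θ).1 hc
  have hnone : c none = 0 :=
    (mul_eq_zero.1 ((hmark i).symm.trans hi)).resolve_right
      (zero_lt_one.trans_le (one_le_mark hθ i)).ne'
  ext j
  rw [hmark j, hnone, zero_mul, Pi.zero_apply]

section Coefficients

variable {k : ι} {n : Option b.support → ℕ} (hn : P.root k = ∑ i, n i • extRoot b θ i)
include hn

omit hθ in
lemma repr_root_eq_sub_mul_mark (j : b.support) :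
    b.toWeightBasis.repr (P.root k) j = n (some j) - n none * mark b θ (some j) := by
  rw [← repr_sum_smul_extRoot b θ (fun j => (n j : ℝ)) j, hn]
  simp only [Nat.cast_smul_eq_nsmul]

lemma coeff_none_le_one {i : Option b.support} (hi : n i = 0) : n none ≤ 1 := by
  cases i with
  | none => omega
  | some i =>
    have hrepr := neg_mark_le_repr_root hθ k i
    rw [repr_root_eq_sub_mul_mark hn, hi, Nat.cast_zero, zero_sub, neg_le_neg_iff] at hrepr
    have : (n none : ℝ) ≤ 1 :=
      le_of_mul_le_mul_right (by rwa [one_mul]) (zero_lt_one.trans_le (one_le_mark hθ (some i)))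
    exact_mod_cast this

lemma coeff_le_mark {i : Option b.support} (hi : n i = 0) (j : Option b.support) :
    (n j : ℝ) ≤ mark b θ j := by
  have hle := coeff_none_le_one hθ hn hi
  cases j with
  | none => simpa [mark] using hle
  | some j =>
    have hj := repr_root_eq_sub_mul_mark hn j
    obtain h0 | h1 : n none = 0 ∨ n none = 1 := by omega
    · have := repr_root_le_mark hθ k j
      simp only [h0, Nat.cast_zero, zero_mul, sub_zero] at hj
      linarith
    · obtain ⟨i, rfl⟩ := Option.ne_none_iff_exists'.1 (by rintro rfl; omega : i ≠ none)
      -- the root is negative, since its coefficient at the node `i` is minus the mark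
      have hneg : b.toWeightBasis.repr (P.root k) i < 0 := by
        rw [repr_root_eq_sub_mul_mark hn, hi, h1]
        have := one_le_mark hθ (some i)
        norm_num
        linarith
      have := repr_root_nonpos_of_repr_root_neg b hneg j
      rw [h1, Nat.cast_one, one_mul] at hj
      linarith

end Coefficients

end ExtendedDiagram

/-! ### The density of the positive roots of a subdiagram -/

section SubdiagramDensity

variable {ι M 𝔱 : Type*} [Fintype ι] [AddCommGroup M] [Module ℝ M] [AddCommGroup 𝔱] [Module ℝ 𝔱]
  {P : RootPairing ι ℝ M 𝔱} {b : P.Base} {θ : ι}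

lemma mem_subPosRoots_iff {K : Finset (Option b.support)} {k : ι} :
    k ∈ subPosRoots b θ K ↔
      ∃ n : Option b.support → ℕ, (∀ j ∉ K, n j = 0) ∧ P.root k = ∑ i, n i • extRoot b θ i := by
  classical
  rw [subPosRoots, Finset.mem_filter_univ, mem_closure_image_extRoot_iff]

lemma subPosRoots_mono : Monotone (subPosRoots b θ) := by
  intro K L hKL k hk
  obtain ⟨n, hn, hkn⟩ := mem_subPosRoots_iff.1 hk
  exact mem_subPosRoots_iff.2 ⟨n, fun j hj => hn j fun hjK => hj (hKL hjK), hkn⟩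

lemma root_mem_span_of_mem_subPosRoots {K : Finset (Option b.support)} {k : ι}
    (hk : k ∈ subPosRoots b θ K) :
    P.root k ∈ Submodule.span ℝ (extRoot b θ '' (K : Set (Option b.support))) := by
  rw [← Submodule.mem_toAddSubmonoid]
  exact AddSubmonoid.closure_le.2 Submodule.subset_span (by simpa [subPosRoots] using hk)

lemma card_le_two_mul_card_posRoots (b : P.Base) : Fintype.card ι ≤ 2 * (posRoots b).card := by
  classical
  let := P.indexNeg
  have univ_subset : Finset.univ ⊆ posRoots b ∪ (posRoots b).image (-·) := fun k _ => by
    rw [Finset.mem_union, Finset.mem_image]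
    rcases b.root_mem_or_neg_mem k with hk | hk
    · exact .inl (by simpa [posRoots] using hk)
    · exact .inr ⟨-k, by simpa [posRoots] using hk, neg_neg k⟩
  calc Fintype.card ι
      ≤ (posRoots b ∪ (posRoots b).image (-·)).card := Finset.card_le_card univ_subset
    _ ≤ (posRoots b).card + ((posRoots b).image (-·)).card := Finset.card_union_le _ _
    _ ≤ (posRoots b).card + (posRoots b).card := Nat.add_le_add_left Finset.card_image_le _
    _ = 2 * (posRoots b).card := (two_mul _).symm

variable [P.IsRootSystem] (hθ : IsHighestRoot b θ) {K : Finset (Option b.support)}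
  {i : Option b.support} (hi : i ∉ K)
include hθ hi

lemma not_mem_subPosRoots_of_root_eq_neg {k l : ι} (hk : k ∈ subPosRoots b θ K)
    (hl : P.root l = -P.root k) : l ∉ subPosRoots b θ K := by
  intro hl'
  obtain ⟨n, hn, hkn⟩ := mem_subPosRoots_iff.1 hk
  obtain ⟨n', hn', hln'⟩ := mem_subPosRoots_iff.1 hl'
  have hzero : (fun j => (n j : ℝ) + n' j) = 0 := by
    refine eq_zero_of_sum_smul_extRoot_eq_zero hθ (i := i) ?_ (by simp [hn i hi, hn' i hi])
    simp only [add_smul, Finset.sum_add_distrib, Nat.cast_smul_eq_nsmul, ← hkn, ← hln', hl,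
      add_neg_cancel]
  refine P.ne_zero k (hkn.trans (Finset.sum_eq_zero fun j _ => ?_))
  have hj : (n j : ℝ) + n' j = 0 := congrFun hzero j
  have hnj : n j + n' j = 0 := by exact_mod_cast hj
  rw [(Nat.add_eq_zero_iff.1 hnj).1, zero_smul]

lemma two_mul_card_subPosRoots_le
    [DecidablePred (P.root · ∈ Submodule.span ℝ (extRoot b θ '' (K : Set (Option b.support))))] :
    2 * (subPosRoots b θ K).card ≤ Finset.card
      {k | P.root k ∈ Submodule.span ℝ (extRoot b θ '' (K : Set (Option b.support)))} := by
  classical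
  let := P.indexNeg
  have hdisj : Disjoint (subPosRoots b θ K) ((subPosRoots b θ K).image (-·)) := by
    rw [Finset.disjoint_right]
    intro l hl
    obtain ⟨k, hk, rfl⟩ := Finset.mem_image.1 hl
    exact not_mem_subPosRoots_of_root_eq_neg hθ hi hk (by simp)
  calc 2 * (subPosRoots b θ K).card
      = (subPosRoots b θ K ∪ (subPosRoots b θ K).image (-·)).card := by
        rw [Finset.card_union_of_disjoint hdisj, Finset.card_image_of_injective _ neg_injective,
          two_mul]
    _ ≤ _ := Finset.card_le_card fun k hk => by
        rw [Finset.mem_filter_univ]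
        rcases Finset.mem_union.1 hk with hk | hk
        · exact root_mem_span_of_mem_subPosRoots hk
        · obtain ⟨l, hl, rfl⟩ := Finset.mem_image.1 hk
          simpa using root_mem_span_of_mem_subPosRoots hl

theorem card_subPosRoots_mul_card_support_le [P.IsIrreducible] :
    (subPosRoots b θ K).card * b.support.card ≤ K.card * (posRoots b).card := by
  classical
  set V := Submodule.span ℝ (extRoot b θ '' (K : Set (Option b.support)))
  have finrank_le : Module.finrank ℝ V ≤ K.card := by
    have := finrank_span_finset_le_card (R := ℝ) (K.image (extRoot b θ))
    rw [Finset.coe_image] at this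
    exact this.trans Finset.card_image_le
  have := calc 2 * (subPosRoots b θ K).card * b.support.card
      ≤ Finset.card {k | P.root k ∈ V} * b.support.card :=
        Nat.mul_le_mul_right _ (two_mul_card_subPosRoots_le hθ hi)
    _ ≤ Module.finrank ℝ V * Fintype.card ι :=
        finrank_eq_card_support b ▸ card_filter_root_mem_mul_finrank_le P V
    _ ≤ K.card * (2 * (posRoots b).card) :=
        Nat.mul_le_mul finrank_le (card_le_two_mul_card_posRoots b)
  linarith

end SubdiagramDensity

/-! ### The layer cake inequality for finite products -/

section LayerCake

open MeasureTheory Set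

variable {α β : Type*}

lemma integral_Ioi_indicator_Iio_one (y : ℝ) :
    ∫ t in Ioi 0, (Iio y).indicator (1 : ℝ → ℝ) t = max y 0 := by
  rw [integral_indicator_one measurableSet_Iio, measureReal_restrict_apply measurableSet_Iio,
    Iio_inter_Ioi, Real.volume_real_Ioo, sub_zero]

lemma integrableOn_Ioi_indicator_Iio_one (y : ℝ) :
    IntegrableOn ((Iio y).indicator (1 : ℝ → ℝ)) (Ioi 0) := by
  refine (integrable_indicator_iff measurableSet_Iio).2 (integrableOn_const ?_)
  rw [Measure.restrict_apply measurableSet_Iio, Iio_inter_Ioi]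
  exact measure_Ioo_lt_top.ne

lemma card_filter_lt_eq_sum_indicator (A : Finset α) (f : α → ℝ) (t : ℝ) :
    (Finset.card {a ∈ A | t < f a} : ℝ) = ∑ a ∈ A, (Iio (f a)).indicator 1 t := by
  simp [Set.indicator_apply]

lemma integrableOn_card_filter_lt (A : Finset α) (f : α → ℝ) :
    IntegrableOn (fun t => (Finset.card {a ∈ A | t < f a} : ℝ)) (Ioi 0) := by
  simp only [card_filter_lt_eq_sum_indicator]
  exact integrable_finsetSum _ fun a _ => integrableOn_Ioi_indicator_Iio_one (f a)

lemma integral_card_filter_lt (A : Finset α) (f : α → ℝ) :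
    ∫ t in Ioi 0, (Finset.card {a ∈ A | t < f a} : ℝ) = ∑ a ∈ A, max (f a) 0 := by
  simp only [card_filter_lt_eq_sum_indicator]
  rw [integral_finsetSum _ fun a _ => integrableOn_Ioi_indicator_Iio_one (f a)]
  simp only [integral_Ioi_indicator_Iio_one]

lemma sum_le_mul_sum_of_card_filter_lt_le {A : Finset α} {B : Finset β} {f : α → ℝ} {g : β → ℝ}
    {ρ : ℝ} (hg : ∀ j ∈ B, 0 ≤ g j)
    (hcard : ∀ t > 0, (Finset.card {a ∈ A | t < f a} : ℝ) ≤ ρ * Finset.card {j ∈ B | t < g j}) :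
    ∑ a ∈ A, f a ≤ ρ * ∑ j ∈ B, g j :=
  calc ∑ a ∈ A, f a ≤ ∑ a ∈ A, max (f a) 0 := Finset.sum_le_sum fun a _ => le_max_left _ _
    _ = ∫ t in Ioi 0, (Finset.card {a ∈ A | t < f a} : ℝ) := (integral_card_filter_lt A f).symm
    _ ≤ ∫ t in Ioi 0, ρ * (Finset.card {j ∈ B | t < g j} : ℝ) :=
        setIntegral_mono_on (integrableOn_card_filter_lt A f)
          ((integrableOn_card_filter_lt B g).const_mul ρ) measurableSet_Ioi hcard
    _ = ρ * ∑ j ∈ B, max (g j) 0 := by rw [integral_const_mul, integral_card_filter_lt]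
    _ = ρ * ∑ j ∈ B, g j := by rw [Finset.sum_congr rfl fun j hj => max_eq_left (hg j hj)]

theorem prod_rpow_le_prod_of_card_filter_lt_le {A : Finset α} {B : Finset β} {x : α → ℝ}
    {y : β → ℝ} {ρ : ℝ} (hx : ∀ a ∈ A, 0 < x a) (hy : ∀ j ∈ B, 0 < y j ∧ y j ≤ 1)
    (hcard : ∀ u, 0 < u → u < 1 →
      (Finset.card {a ∈ A | x a < u} : ℝ) ≤ ρ * Finset.card {j ∈ B | y j < u}) :
    ∏ j ∈ B, y j ^ ρ ≤ ∏ a ∈ A, x a := by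
  have lt_neg_log {z : ℝ} (hz : 0 < z) (t : ℝ) : t < -Real.log z ↔ z < Real.exp (-t) := by
    rw [lt_neg, Real.log_lt_iff_lt_exp hz]
  have hsum : ∑ a ∈ A, -Real.log (x a) ≤ ρ * ∑ j ∈ B, -Real.log (y j) := by
    refine sum_le_mul_sum_of_card_filter_lt_le
      (fun j hj => neg_nonneg.2 (Real.log_nonpos (hy j hj).1.le (hy j hj).2)) fun t ht => ?_
    rw [Finset.filter_congr fun a ha => lt_neg_log (hx a ha) t,
      Finset.filter_congr fun j hj => lt_neg_log (hy j hj).1 t]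
    exact hcard _ (Real.exp_pos _) ((Real.exp_lt_one_iff.2 (neg_neg_of_pos ht)))
  rw [Finset.sum_neg_distrib, Finset.sum_neg_distrib, ← Real.log_prod fun a ha => (hx a ha).ne',
    ← Real.log_prod fun j hj => (hy j hj).1.ne', mul_neg, neg_le_neg_iff] at hsum
  have hprod : 0 < ∏ j ∈ B, y j := Finset.prod_pos fun j hj => (hy j hj).1
  rw [Real.finsetProd_rpow _ _ fun j hj => (hy j hj).1.le]
  refine (Real.log_le_log_iff (Real.rpow_pos_of_pos hprod ρ) (Finset.prod_pos hx)).1 ?_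
  rwa [Real.log_rpow hprod]

end LayerCake

/-! ### The factors of the weight function -/

section WallCoordinates

variable {ι M 𝔱 : Type*} [AddCommGroup M] [Module ℝ M] [AddCommGroup 𝔱] [Module ℝ 𝔱]
  {P : RootPairing ι ℝ M 𝔱}

/-- The coordinate `t_j`, as an affine form on `𝔱`. -/
noncomputable def wallAffine (b : P.Base) (θ : ι) (j : Option b.support) : 𝔱 →ᵃ[ℝ] ℝ :=
  ((2 * Real.pi)⁻¹ • P.toLinearMap (extRoot b θ j)).toAffineMap
    + AffineMap.const ℝ 𝔱 (if j = none then 1 else 0)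

lemma coe_wallAffine (b : P.Base) (θ : ι) (j : Option b.support) :
    ⇑(wallAffine b θ j) = wallCoord b θ j := by
  ext H
  simp [wallAffine, wallCoord, div_eq_inv_mul]

lemma toLinearMap_extRoot_apply (b : P.Base) (θ : ι) (j : Option b.support) (H : 𝔱) :
    P.toLinearMap (extRoot b θ j) H
      = 2 * Real.pi * (wallCoord b θ j H - if j = none then 1 else 0) := by
  rw [wallCoord, add_sub_cancel_right, mul_div_cancel₀ _ Real.two_pi_pos.ne']

lemma toLinearMap_sum_smul_extRoot_apply (b : P.Base) (θ : ι) (n : Option b.support → ℕ) (H : 𝔱) :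
    P.toLinearMap (∑ i, n i • extRoot b θ i) H
      = 2 * Real.pi * (∑ i, n i * wallCoord b θ i H - n none) := by
  have hite : ∑ i, (n i : ℝ) * (if i = none then 1 else 0) = n none := by simp
  simp only [map_sum, map_nsmul, LinearMap.sum_apply, LinearMap.smul_apply,
    toLinearMap_extRoot_apply, nsmul_eq_mul, mul_left_comm _ (2 * Real.pi)]
  rw [← Finset.mul_sum, ← hite, ← Finset.sum_sub_distrib]
  simp only [mul_sub]

section

variable [P.IsRootSystem] {b : P.Base} {θ : ι}

lemma sum_mark_mul_wallCoord (b : P.Base) (θ : ι) (H : 𝔱) :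
    ∑ j, mark b θ j * wallCoord b θ j H = 1 := by
  have h := congrArg (P.toLinearMap · H) (sum_mark_smul_extRoot b θ)
  simp only [map_sum, map_smul, LinearMap.sum_apply, LinearMap.smul_apply, smul_eq_mul, map_zero,
    LinearMap.zero_apply] at h
  simp only [wallCoord, mul_add, Finset.sum_add_distrib, ← mul_div_assoc, ← Finset.sum_div, h]
  simp [mark]

lemma wallCoord_le_one_of_mem_alcove (hθ : IsHighestRoot b θ) {H : 𝔱} (hH : H ∈ alcove b θ)
    (j : Option b.support) : wallCoord b θ j H ≤ 1 := by
  have nonneg (j) : 0 ≤ mark b θ j * wallCoord b θ j H :=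
    mul_nonneg (zero_le_one.trans (one_le_mark hθ j)) (hH j).le
  calc wallCoord b θ j H ≤ mark b θ j * wallCoord b θ j H :=
        le_mul_of_one_le_left (hH j).le (one_le_mark hθ j)
    _ ≤ ∑ j, mark b θ j * wallCoord b θ j H :=
        Finset.single_le_sum (fun j _ => nonneg j) (Finset.mem_univ j)
    _ = 1 := sum_mark_mul_wallCoord b θ H

lemma mark_mul_wallCoord_of_mem_facet_erase {i : Option b.support} {x : 𝔱}
    [DecidableEq (Option b.support)]
    (hx : x ∈ facet b θ (Finset.univ.erase i)) : mark b θ i * wallCoord b θ i x = 1 := by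
  have hzero (j) (hj : j ≠ i) : mark b θ j * wallCoord b θ j x = 0 := by
    rw [hx.1 j (Finset.mem_erase.2 ⟨hj, Finset.mem_univ j⟩), mul_zero]
  rw [← sum_mark_mul_wallCoord b θ x,
    Finset.sum_eq_single_of_mem i (Finset.mem_univ i) fun j _ hj => hzero j hj]

open Classical in
lemma IsFacetBarycenter.mark_mul_wallCoord {K : Finset (Option b.support)} {x : 𝔱}
    (hx : IsFacetBarycenter b θ K x) {i : Option b.support} (hi : i ∉ K) :
    mark b θ i * wallCoord b θ i x = (Kᶜ.card : ℝ)⁻¹ := by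
  obtain ⟨v, hv, rfl⟩ := hx
  have hiK : i ∈ Kᶜ := Finset.mem_compl.2 hi
  have hsum := Finset.sum_centroidWeights_eq_one_of_nonempty ℝ _ ⟨i, hiK⟩
  have wallCoord_vertex (k : Option b.support) (hk : k ≠ i) : wallCoord b θ i (v k) = 0 :=
    (hv k).1 i (Finset.mem_erase.2 ⟨hk.symm, Finset.mem_univ i⟩)
  rw [← coe_wallAffine, Finset.centroid_def, Finset.map_affineCombination _ _ _ hsum,
    Finset.affineCombination_eq_linear_combination _ _ _ hsum, coe_wallAffine,
    Finset.sum_eq_single_of_mem i hiK fun k _ hk => by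
      rw [Function.comp_apply, wallCoord_vertex k hk, smul_zero],
    Function.comp_apply, Finset.centroidWeights_apply, smul_eq_mul, mul_left_comm,
    mark_mul_wallCoord_of_mem_facet_erase (hv i), mul_one]

lemma inv_card_le_mark_mul_wallCoord_of_mem_baryPiece {I : Finset (Option b.support)}
    {i : Option b.support} (hi : i ∉ I) {H : 𝔱} (hH : H ∈ baryPiece b θ I) :
    (Fintype.card (Option b.support) : ℝ)⁻¹ ≤ mark b θ i * wallCoord b θ i H := by
  classical
  suffices baryPiece b θ I ⊆ (mark b θ i • wallAffine b θ i) ⁻¹'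
      Set.Ici (Fintype.card (Option b.support) : ℝ)⁻¹ by
    simpa [coe_wallAffine] using this hH
  refine convexHull_min ?_ ((convex_Ici _).affine_preimage _)
  rintro x ⟨K, hK, hx⟩
  have hiK : i ∉ K := fun h => hi (hK h)
  have hcard : (0 : ℝ) < Kᶜ.card :=
    Nat.cast_pos.2 (Finset.card_pos.2 ⟨i, Finset.mem_compl.2 hiK⟩)
  rw [Set.mem_preimage, AffineMap.coe_smul, Pi.smul_apply, coe_wallAffine, smul_eq_mul,
    hx.mark_mul_wallCoord hiK]
  exact inv_anti₀ hcard (Nat.cast_le.2 (Finset.card_le_univ _))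

end

end WallCoordinates

section WeylFactor

variable {ι M 𝔱 : Type*} [AddCommGroup M] [Module ℝ M] [AddCommGroup 𝔱] [Module ℝ 𝔱]
  {P : RootPairing ι ℝ M 𝔱}

/-- The factor `e^{α(H)/2} - e^{-α(H)/2}` of the weight function at the root `α = i P.root k`. -/
noncomputable def weylFactor (P : RootPairing ι ℝ M 𝔱) (k : ι) (H : 𝔱) : ℂ :=
  Complex.exp (rootValue P k H / 2) - Complex.exp (-(rootValue P k H / 2))

lemma norm_weylFactor (k : ι) (H : 𝔱) :
    ‖weylFactor P k H‖ = 2 * |Real.sin (P.toLinearMap (P.root k) H / 2)| := by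
  have hsin : weylFactor P k H
      = 2 * Complex.I * (Real.sin (P.toLinearMap (P.root k) H / 2) : ℂ) := by
    have hvalue : rootValue P k H / 2
        = ((P.toLinearMap (P.root k) H / 2 : ℝ) : ℂ) * Complex.I := by
      rw [rootValue]
      push_cast
      ring
    rw [weylFactor, hvalue, ← neg_mul, Complex.exp_mul_I, Complex.exp_mul_I, Complex.cos_neg,
      Complex.sin_neg, Complex.ofReal_sin]
    ring
  rw [hsin, norm_mul, norm_mul, Complex.norm_I, Complex.norm_real, Complex.norm_two, mul_one,
    Real.norm_eq_abs]

lemma norm_weylFactor_of_root_eq_sum {b : P.Base} {θ k : ι} {n : Option b.support → ℕ}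
    (hn : P.root k = ∑ i, n i • extRoot b θ i) (H : 𝔱) :
    ‖weylFactor P k H‖ = 2 * |Real.sin (Real.pi * ∑ i, n i * wallCoord b θ i H)| := by
  have harg : 2 * Real.pi * (∑ i, n i * wallCoord b θ i H - n none) / 2
      = Real.pi * ∑ i, n i * wallCoord b θ i H - n none * Real.pi := by ring
  rw [norm_weylFactor, hn, toLinearMap_sum_smul_extRoot_apply, harg, Real.sin_sub_nat_mul_pi,
    abs_mul, abs_pow, abs_neg, abs_one, one_pow, one_mul]

lemma two_mul_mul_le_sin_pi_mul {s d : ℝ} (hs : 0 ≤ s) (hd : 0 ≤ d) (hsd : s ≤ 1 - d) :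
    2 * d * s ≤ Real.sin (Real.pi * s) := by
  have two_mul_le_sin {u : ℝ} (hu : 0 ≤ u) (hu' : u ≤ 1 / 2) :
      2 * u ≤ Real.sin (Real.pi * u) := by
    have h := Real.mul_le_sin (x := Real.pi * u) (by positivity) (by nlinarith [Real.pi_pos])
    rwa [← mul_assoc, div_mul_cancel₀ _ Real.pi_ne_zero] at h
  rcases le_total s (1 / 2) with h | h
  · exact le_trans (by nlinarith) (two_mul_le_sin hs h)
  · have hsymm := two_mul_le_sin (u := 1 - s) (by linarith) (by linarith)
    rw [mul_one_sub Real.pi, Real.sin_pi_sub] at hsymm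
    nlinarith

lemma prod_weylFactor_eq_weight [Fintype ι] [DecidableEq ι] (b : P.Base) (θ : ι)
    (I J : Finset (Option b.support)) (H : 𝔱) :
    ∏ k ∈ subPosRoots b θ I \ subPosRoots b θ J, weylFactor P k H = weight b θ I J H := by
  unfold weight
  congr!

variable [P.IsRootSystem] {b : P.Base} {θ : ι} (hθ : IsHighestRoot b θ)
include hθ

lemma sum_coeff_mul_wallCoord_le {I : Finset (Option b.support)} {i : Option b.support}
    (hi : i ∉ I) {k : ι} {n : Option b.support → ℕ} (hnI : ∀ j ∉ I, n j = 0)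
    (hn : P.root k = ∑ i, n i • extRoot b θ i) {H : 𝔱} (hA : H ∈ alcove b θ)
    (hB : H ∈ baryPiece b θ I) :
    ∑ j, n j * wallCoord b θ j H ≤ 1 - (Fintype.card (Option b.support) : ℝ)⁻¹ := by
  classical
  have coeff_mul_le (j) : (n j : ℝ) * wallCoord b θ j H ≤ mark b θ j * wallCoord b θ j H :=
    mul_le_mul_of_nonneg_right (coeff_le_mark hθ hn (hnI i hi) j) (hA j).le
  have herase : ∑ j, (n j : ℝ) * wallCoord b θ j H
      = ∑ j ∈ Finset.univ.erase i, (n j : ℝ) * wallCoord b θ j H := by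
    rw [← Finset.sum_erase _ (a := i)]
    rw [hnI i hi, Nat.cast_zero, zero_mul]
  have hsum := Finset.sum_erase_add Finset.univ (fun j => mark b θ j * wallCoord b θ j H)
    (Finset.mem_univ i)
  rw [sum_mark_mul_wallCoord] at hsum
  have hle := Finset.sum_le_sum fun j (_ : j ∈ Finset.univ.erase i) => coeff_mul_le j
  have := inv_card_le_mark_mul_wallCoord_of_mem_baryPiece hi hB
  linarith

theorem exists_wallCoord_le_norm_weylFactor [Fintype ι] {I : Finset (Option b.support)}
    {i : Option b.support} (hi : i ∉ I) {K : Finset (Option b.support)} {k : ι}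
    (hk : k ∈ subPosRoots b θ I) (hkK : k ∉ subPosRoots b θ K) {H : 𝔱}
    (hA : H ∈ alcove b θ) (hB : H ∈ baryPiece b θ I) :
    ∃ j ∈ I, j ∉ K ∧
      4 * (Fintype.card (Option b.support) : ℝ)⁻¹ * wallCoord b θ j H ≤ ‖weylFactor P k H‖ := by
  obtain ⟨n, hnI, hn⟩ := mem_subPosRoots_iff.1 hk
  obtain ⟨j, hjK, hj⟩ : ∃ j ∉ K, n j ≠ 0 := by
    by_contra! h
    exact hkK (mem_subPosRoots_iff.2 ⟨n, h, hn⟩)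
  refine ⟨j, not_imp_comm.1 (hnI j) hj, hjK, ?_⟩
  set d : ℝ := (Fintype.card (Option b.support) : ℝ)⁻¹
  have hd : 0 ≤ d := by positivity
  have term_nonneg (j) : 0 ≤ n j * wallCoord b θ j H := mul_nonneg (Nat.cast_nonneg _) (hA j).le
  have wallCoord_le : wallCoord b θ j H ≤ ∑ j, n j * wallCoord b θ j H :=
    (le_mul_of_one_le_left (hA j).le (Nat.one_le_cast.2 (Nat.one_le_iff_ne_zero.2 hj))).trans
      (Finset.single_le_sum (fun j _ => term_nonneg j) (Finset.mem_univ j))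
  have hsin := two_mul_mul_le_sin_pi_mul (Finset.sum_nonneg fun j _ => term_nonneg j) hd
    (sum_coeff_mul_wallCoord_le hθ hi hnI hn hA hB)
  rw [norm_weylFactor_of_root_eq_sum hn]
  calc 4 * d * wallCoord b θ j H ≤ 2 * (2 * d * ∑ j, n j * wallCoord b θ j H) := by
        linarith [mul_le_mul_of_nonneg_left wallCoord_le hd]
    _ ≤ 2 * |Real.sin (Real.pi * ∑ j, n j * wallCoord b θ j H)| :=
        mul_le_mul_of_nonneg_left (hsin.trans (le_abs_self _)) zero_le_two

end WeylFactor

/-! ### The pointwise bound -/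

section PointwiseBound

variable {ι M 𝔱 : Type*} [AddCommGroup M] [Module ℝ M] [AddCommGroup 𝔱] [Module ℝ 𝔱]
  {P : RootPairing ι ℝ M 𝔱} {b : P.Base} {θ : ι}

variable [Fintype ι] {N : ℝ} {I J : Finset (Option b.support)}

open Classical in
/-- The size of the factor of `δ_I` at the root `k`, replaced by `N⁻¹` on the roots of `Σ_J⁺`. The
normalization makes it at least `t_j` for some node `j` outside any given `K ⊆ I` with `k` not in
`Σ_K⁺`. -/
noncomputable def truncFactor (b : P.Base) (θ : ι) (N : ℝ) (J : Finset (Option b.support)) (k : ι)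
    (H : 𝔱) : ℝ :=
  if k ∈ subPosRoots b θ J then N⁻¹
  else ‖weylFactor P k H‖ / (4 * (Fintype.card (Option b.support) : ℝ)⁻¹)

lemma prod_truncFactor (hJ : J ⊆ I) (H : 𝔱) :
    ∏ k ∈ subPosRoots b θ I, truncFactor b θ N J k H
      = ‖weight b θ I J H‖ / ((4 * (Fintype.card (Option b.support) : ℝ)⁻¹) ^
          ((subPosRoots b θ I).card - (subPosRoots b θ J).card)
        * N ^ (subPosRoots b θ J).card) := by
  classical
  have hsub : subPosRoots b θ J ⊆ subPosRoots b θ I := subPosRoots_mono hJ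
  have on_sdiff : ∀ k ∈ subPosRoots b θ I \ subPosRoots b θ J, truncFactor b θ N J k H
      = ‖weylFactor P k H‖ / (4 * (Fintype.card (Option b.support) : ℝ)⁻¹) := fun k hk =>
    if_neg (Finset.mem_sdiff.1 hk).2
  have on_sub : ∀ k ∈ subPosRoots b θ J, truncFactor b θ N J k H = N⁻¹ := fun k hk => if_pos hk
  rw [← Finset.prod_sdiff hsub, Finset.prod_congr rfl on_sdiff, Finset.prod_congr rfl on_sub,
    Finset.prod_div_distrib, Finset.prod_const, Finset.prod_const, ← norm_prod,
    prod_weylFactor_eq_weight, Finset.card_sdiff_of_subset hsub, inv_pow, ← div_eq_mul_inv,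
    div_div]

variable [P.IsRootSystem] (hθ : IsHighestRoot b θ) {i : Option b.support} (hi : i ∉ I) {H : 𝔱}
include hθ hi

lemma exists_wallCoord_le_truncFactor {K : Finset (Option b.support)} {k : ι}
    (hk : k ∈ subPosRoots b θ I) (hkJ : k ∉ subPosRoots b θ J) (hkK : k ∉ subPosRoots b θ K)
    (hA : H ∈ alcove b θ) (hB : H ∈ baryPiece b θ I) :
    ∃ j ∈ I, j ∉ K ∧ wallCoord b θ j H ≤ truncFactor b θ N J k H := by
  obtain ⟨j, hj, hjK, hle⟩ := exists_wallCoord_le_norm_weylFactor hθ hi hk hkK hA hB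
  refine ⟨j, hj, hjK, ?_⟩
  rw [truncFactor, if_neg hkJ, le_div_iff₀ (by positivity), mul_comm]
  exact hle

lemma inv_le_truncFactor {k : ι} (hk : k ∈ subPosRoots b θ I) (hH : H ∈ piece b θ N I J) :
    N⁻¹ ≤ truncFactor b θ N J k H := by
  by_cases hkJ : k ∈ subPosRoots b θ J
  · rw [truncFactor, if_pos hkJ]
  · obtain ⟨j, -, hj, hle⟩ := exists_wallCoord_le_truncFactor hθ hi hk hkJ hkJ hH.1.1 hH.2
    exact (hH.1.2.2 j hj).le.trans hle

lemma filter_truncFactor_lt_subset (hJ : J ⊆ I) (hH : H ∈ piece b θ N I J) (u : ℝ) :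
    {k ∈ subPosRoots b θ I | truncFactor b θ N J k H < u} ⊆
      subPosRoots b θ {j ∈ I | max (wallCoord b θ j H) N⁻¹ < u} := by
  intro k hk
  obtain ⟨hk, hku⟩ := Finset.mem_filter.1 hk
  have hNu : N⁻¹ < u := (inv_le_truncFactor hθ hi hk hH).trans_lt hku
  have hJK : J ⊆ {j ∈ I | max (wallCoord b θ j H) N⁻¹ < u} := fun j hj =>
    Finset.mem_filter.2 ⟨hJ hj, max_lt ((hH.1.2.1 j hj).trans_lt hNu) hNu⟩
  by_contra hkK
  obtain ⟨j, hj, hjK, hle⟩ := exists_wallCoord_le_truncFactor (N := N) hθ hi hk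
    (fun h => hkK (subPosRoots_mono hJK h)) hkK hH.1.1 hH.2
  exact hjK (Finset.mem_filter.2 ⟨hj, max_lt (hle.trans_lt hku) hNu⟩)

variable [P.IsIrreducible]

lemma card_subPosRoots_le_div_mul_card {K : Finset (Option b.support)} (hK : K ⊆ I) :
    ((subPosRoots b θ K).card : ℝ) ≤ (posRoots b).card / b.support.card * K.card := by
  have : Nonempty ι := ⟨θ⟩
  have : (0 : ℝ) < b.support.card := Nat.cast_pos.2 (Finset.card_pos.2 b.support_nonempty)
  rw [div_mul_eq_mul_div, le_div_iff₀ this, mul_comm ((posRoots b).card : ℝ)]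
  exact_mod_cast card_subPosRoots_mul_card_support_le hθ fun h => hi (hK h)

theorem norm_one_div_weight_le (hJ : J ⊆ I) (hN : 1 ≤ N) (hH : H ∈ piece b θ N I J) :
    ‖1 / weight b θ I J H‖ ≤
      ((4 * (Fintype.card (Option b.support) : ℝ)⁻¹) ^
          ((subPosRoots b θ I).card - (subPosRoots b θ J).card)
        * N ^ (subPosRoots b θ J).card)⁻¹
        * ∏ j ∈ I, max (wallCoord b θ j H) N⁻¹ ^ (-((posRoots b).card / b.support.card : ℝ)) := by
  set ρ : ℝ := (posRoots b).card / b.support.card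
  have hNpos : 0 < N := zero_lt_one.trans_le hN
  have max_pos (j) : 0 < max (wallCoord b θ j H) N⁻¹ := lt_max_of_lt_right (inv_pos.2 hNpos)
  have hprod : ∏ j ∈ I, max (wallCoord b θ j H) N⁻¹ ^ ρ
      ≤ ∏ k ∈ subPosRoots b θ I, truncFactor b θ N J k H := by
    refine prod_rpow_le_prod_of_card_filter_lt_le
      (fun k hk => (inv_pos.2 hNpos).trans_le (inv_le_truncFactor hθ hi hk hH))
      (fun j _ => ⟨max_pos j, max_le (wallCoord_le_one_of_mem_alcove hθ hH.1.1 j)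
        (inv_le_one_of_one_le₀ hN)⟩) fun u _ _ => ?_
    exact (Nat.cast_le.2 (Finset.card_le_card (filter_truncFactor_lt_subset hθ hi hJ hH u))).trans
      (card_subPosRoots_le_div_mul_card hθ hi (Finset.filter_subset _ _))
  rw [prod_truncFactor hJ, le_div_iff₀ (by positivity)] at hprod
  have prod_pos : 0 < ∏ j ∈ I, max (wallCoord b θ j H) N⁻¹ ^ ρ :=
    Finset.prod_pos fun j _ => Real.rpow_pos_of_pos (max_pos j) ρ
  simp only [Real.rpow_neg (max_pos _).le, Finset.prod_inv_distrib]
  rw [norm_div, norm_one, one_div, ← mul_inv, mul_comm]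
  exact inv_anti₀ (mul_pos prod_pos (by positivity)) hprod

end PointwiseBound

/-! ### Norms of truncated powers -/

section TruncatedPowers

open MeasureTheory Set

lemma eLpNorm_pi_prod_le {κ 𝕜 : Type*} [Fintype κ] [NormedField 𝕜] {α : κ → Type*}
    [∀ j, MeasurableSpace (α j)] (ν : ∀ j, Measure (α j)) [∀ j, IsProbabilityMeasure (ν j)]
    {f : ∀ j, α j → 𝕜} (hf : ∀ j, StronglyMeasurable (f j)) (p : ℝ≥0∞) :
    eLpNorm (fun x => ∏ j, f j (x j)) p (Measure.pi ν) ≤ ∏ j, eLpNorm (f j) p (ν j) := by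
  rcases eq_or_ne p 0 with rfl | hp
  · simp
  have enorm_prod (x : ∀ j, α j) : ‖∏ j, f j (x j)‖ₑ = ∏ j, ‖f j (x j)‖ₑ := by
    simp only [enorm_eq_nnnorm, nnnorm_prod, ENNReal.ofNNReal_finsetProd]
  rcases eq_or_ne p ⊤ with rfl | hp_top
  · simp only [eLpNorm_exponent_top]
    have ae_le : ∀ᵐ x ∂Measure.pi ν, ∀ j, ‖f j (x j)‖ₑ ≤ eLpNormEssSup (f j) (ν j) :=
      Filter.eventually_all.2 fun j =>
        (measurePreserving_eval ν j).quasiMeasurePreserving.ae (enorm_ae_le_eLpNormEssSup (f j) _)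
    refine essSup_le_of_ae_le _ ?_
    filter_upwards [ae_le] with x hx
    rw [enorm_prod]
    exact Finset.prod_le_prod' fun j _ => hx j
  · have hmeas (j) : Measurable fun y : α j => ‖f j y‖ₑ ^ p.toReal := (hf j).enorm.pow_const _
    have hindep := ProbabilityTheory.iIndepFun_pi (μ := ν) fun j => (hmeas j).aemeasurable
    simp only [eLpNorm_eq_lintegral_rpow_enorm_toReal hp hp_top, enorm_prod,
      ← ENNReal.prod_rpow_of_nonneg ENNReal.toReal_nonneg]
    rw [ProbabilityTheory.lintegral_prod_eq_prod_lintegral_of_indepFun _ _ hindep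
      fun j => (hmeas j).comp (measurable_pi_apply j),
      ENNReal.prod_rpow_of_nonneg (by positivity)]
    exact (congrArg (· ^ (1 / p.toReal)) (Finset.prod_congr rfl fun j _ =>
      (measurePreserving_eval ν j).lintegral_comp (hmeas j))).le

lemma eLpNorm_prod_comp_le {E κ : Type*} [MeasurableSpace E] [Fintype κ] {μ : Measure E}
    {T : E → κ → ℝ} (hT : Measurable T) {c : NNReal} (hc : c ≠ 0)
    (hmap : μ.map T = c • volume) {f : ℝ → ℝ} (hf : StronglyMeasurable f) {s : Set ℝ}
    [IsProbabilityMeasure (volume.restrict s)] (hs : MeasurableSet s) (p : ℝ≥0∞) :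
    eLpNorm (fun x => ∏ j, f (T x j)) p (μ.restrict (T ⁻¹' univ.pi fun _ => s)) ≤
      (c ^ p.toReal⁻¹ : NNReal) * eLpNorm f p (volume.restrict s) ^ Fintype.card κ := by
  have hprod : StronglyMeasurable fun y : κ → ℝ => ∏ j, f (y j) :=
    Finset.stronglyMeasurable_fun_prod _ fun j _ => hf.comp_measurable (measurable_pi_apply j)
  have hpi : eLpNorm (fun y : κ → ℝ => ∏ j, f (y j)) p (Measure.pi fun _ => volume.restrict s)
      ≤ eLpNorm f p (volume.restrict s) ^ Fintype.card κ := by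
    simpa using eLpNorm_pi_prod_le (fun _ : κ => volume.restrict s) (fun _ => hf) p
  calc eLpNorm (fun x => ∏ j, f (T x j)) p (μ.restrict (T ⁻¹' univ.pi fun _ => s))
      = eLpNorm (fun y : κ → ℝ => ∏ j, f (y j)) p
          (c • Measure.pi fun _ => volume.restrict s) := by
        rw [← Measure.restrict_pi_pi, ← volume_pi, ← Measure.restrict_smul, ← hmap,
          Measure.restrict_map hT (MeasurableSet.univ_pi fun _ => hs),
          eLpNorm_map_measure hprod.aestronglyMeasurable hT.aemeasurable]
        rfl
    _ = (c ^ p.toReal⁻¹ : NNReal) * eLpNorm (fun y : κ → ℝ => ∏ j, f (y j)) p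
          (Measure.pi fun _ => volume.restrict s) := eLpNorm_smul_measure_of_ne_zero' hc ..
    _ ≤ _ := by gcongr

/-- The `L^p` norm on `(0, 1]` of the power `x ^ (-σ)`, made constant below the scale `N⁻¹`. -/
noncomputable def truncPowerNorm (σ : ℝ) (p : ℝ≥0∞) (N : ℝ) : ℝ≥0∞ :=
  eLpNorm (fun x : ℝ => max x N⁻¹ ^ (-σ)) p (volume.restrict (Ioc 0 1))

lemma continuous_max_rpow {ε : ℝ} (hε : 0 < ε) (a : ℝ) : Continuous fun x => max x ε ^ a :=
  (continuous_id.max continuous_const).rpow_const fun _ => Or.inl (lt_max_of_lt_right hε).ne'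

lemma integral_max_rpow_neg {ε a : ℝ} (hε : 0 < ε) (hε' : ε ≤ 1) (ha : a ≠ 1) :
    ∫ x in 0..1, max x ε ^ (-a) = (1 - a * ε ^ (1 - a)) / (1 - a) := by
  have ha' : 1 - a ≠ 0 := sub_ne_zero.2 ha.symm
  have hint (u v : ℝ) := (continuous_max_rpow hε (-a)).intervalIntegrable (μ := volume) u v
  have below : ∫ x in 0..ε, max x ε ^ (-a) = ε ^ (1 - a) := by
    have hconst : EqOn (fun x => max x ε ^ (-a)) (fun _ => ε ^ (-a)) (uIcc 0 ε) := fun x hx => by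
      simp only [max_eq_right (uIcc_of_le hε.le ▸ hx).2]
    rw [intervalIntegral.integral_congr hconst, intervalIntegral.integral_const, sub_zero,
      smul_eq_mul, ← Real.rpow_one_add' hε.le (by rwa [← sub_eq_add_neg]), ← sub_eq_add_neg]
  have above : ∫ x in ε..1, max x ε ^ (-a) = (1 - ε ^ (1 - a)) / (1 - a) := by
    have hpow : EqOn (fun x => max x ε ^ (-a)) (fun x => x ^ (-a)) (uIcc ε 1) := fun x hx => by
      simp only [max_eq_left (uIcc_of_le hε' ▸ hx).1]
    rw [intervalIntegral.integral_congr hpow, integral_rpow (Or.inr ⟨by contrapose! ha; linarith,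
      fun h => (uIcc_of_le hε' ▸ h).1.not_gt hε⟩), neg_add_eq_sub, Real.one_rpow]
  rw [← intervalIntegral.integral_add_adjacent_intervals (hint 0 ε) (hint ε 1), below, above]
  field_simp
  ring

variable {σ N : ℝ} {p : ℝ≥0∞}

lemma integral_max_inv_rpow_neg (hN : 1 ≤ N) {a : ℝ} (ha : a ≠ 1) :
    ∫ x in 0..1, max x N⁻¹ ^ (-a) = (1 - a * N ^ (a - 1)) / (1 - a) := by
  have hNpos : 0 < N := zero_lt_one.trans_le hN
  rw [integral_max_rpow_neg (inv_pos.2 hNpos) (inv_le_one_of_one_le₀ hN) ha,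
    Real.inv_rpow hNpos.le, ← Real.rpow_neg hNpos.le, neg_sub]

lemma integral_max_rpow_nonneg (hN : 0 < N) (a : ℝ) : 0 ≤ ∫ x in 0..1, max x N⁻¹ ^ a :=
  intervalIntegral.integral_nonneg zero_le_one fun _ _ =>
    Real.rpow_nonneg (lt_max_of_lt_right (inv_pos.2 hN)).le _

lemma truncPowerNorm_eq_ofReal (hN : 0 < N) (hp : p ≠ 0) (hp_top : p ≠ ⊤) :
    truncPowerNorm σ p N
      = ENNReal.ofReal ((∫ x in 0..1, max x N⁻¹ ^ (-(σ * p.toReal))) ^ p.toReal⁻¹) := by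
  have hε : 0 < N⁻¹ := inv_pos.2 hN
  have hmax (x : ℝ) : 0 ≤ max x N⁻¹ := (lt_max_of_lt_right hε).le
  have enorm_rpow (x : ℝ) : ‖max x N⁻¹ ^ (-σ)‖ₑ ^ p.toReal
      = ENNReal.ofReal (max x N⁻¹ ^ (-(σ * p.toReal))) := by
    rw [Real.enorm_of_nonneg (Real.rpow_nonneg (hmax x) _),
      ENNReal.ofReal_rpow_of_nonneg (Real.rpow_nonneg (hmax x) _) ENNReal.toReal_nonneg,
      ← Real.rpow_mul (hmax x), neg_mul]
  have hint : IntegrableOn (fun x => max x N⁻¹ ^ (-(σ * p.toReal))) (Ioc 0 1) :=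
    ((continuous_max_rpow hε _).intervalIntegrable 0 1).1
  rw [truncPowerNorm, eLpNorm_eq_lintegral_rpow_enorm_toReal hp hp_top, one_div,
    lintegral_congr enorm_rpow, ← ofReal_integral_eq_lintegral_ofReal hint
      (Filter.Eventually.of_forall fun x => Real.rpow_nonneg (hmax x) _),
    intervalIntegral.integral_of_le zero_le_one]
  exact ENNReal.ofReal_rpow_of_nonneg (integral_nonneg fun x => Real.rpow_nonneg (hmax x) _)
    (by positivity)

lemma truncPowerNorm_mono (hN : 1 ≤ N) {τ : ℝ} (h : σ ≤ τ) :
    truncPowerNorm σ p N ≤ truncPowerNorm τ p N := by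
  refine eLpNorm_mono_ae ((ae_restrict_mem measurableSet_Ioc).mono fun x hx => ?_)
  have hpos : 0 < max x N⁻¹ := lt_max_of_lt_left hx.1
  rw [Real.norm_of_nonneg (Real.rpow_nonneg hpos.le _),
    Real.norm_of_nonneg (Real.rpow_nonneg hpos.le _)]
  exact Real.rpow_le_rpow_of_exponent_ge hpos (max_le hx.2 (inv_le_one_of_one_le₀ hN))
    (neg_le_neg h)

lemma truncPowerNorm_top_le (hN : 0 < N) (hσ : 0 ≤ σ) :
    truncPowerNorm σ ⊤ N ≤ ENNReal.ofReal (N ^ σ) := by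
  refine eLpNormEssSup_le_of_ae_bound (Filter.Eventually.of_forall fun x => ?_)
  have hpos : 0 < max x N⁻¹ := lt_max_of_lt_right (inv_pos.2 hN)
  rw [Real.norm_of_nonneg (Real.rpow_nonneg hpos.le _), Real.rpow_neg hpos.le,
    ← Real.inv_rpow hpos.le]
  exact Real.rpow_le_rpow (inv_nonneg.2 hpos.le) (inv_le_of_inv_le₀ hN (le_max_right _ _)) hσ

lemma exists_truncPowerNorm_le_rpow (hp : p ≠ 0) {g : ℝ} (hg : 0 < g)
    (hσ : σ ≤ p⁻¹.toReal + g) :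
    ∃ B : ℝ, 0 < B ∧ ∀ N : ℝ, 1 ≤ N → truncPowerNorm σ p N ≤ ENNReal.ofReal (B * N ^ g) := by
  rcases eq_or_ne p ⊤ with rfl | hp_top
  · refine ⟨1, one_pos, fun N hN => (truncPowerNorm_mono hN hσ).trans ?_⟩
    simpa using truncPowerNorm_top_le (zero_lt_one.trans_le hN) hg.le
  set q : ℝ := p.toReal
  have hq : 0 < q := ENNReal.toReal_pos hp hp_top
  have hgq : 0 < g * q := mul_pos hg hq
  refine ⟨((1 + g * q) / (g * q)) ^ q⁻¹, by positivity, fun N hN =>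
    (truncPowerNorm_mono hN hσ).trans ?_⟩
  have hNpos : 0 < N := zero_lt_one.trans_le hN
  have hint : ∫ x in 0..1, max x N⁻¹ ^ (-(1 + g * q)) ≤ (1 + g * q) / (g * q) * N ^ (g * q) := by
    rw [integral_max_inv_rpow_neg hN (by linarith), ← neg_div_neg_eq, div_mul_eq_mul_div,
      add_sub_cancel_left, neg_sub, neg_sub, add_sub_cancel_left]
    exact div_le_div_of_nonneg_right (sub_le_self _ zero_le_one) hgq.le
  have hexp : (p⁻¹.toReal + g) * q = 1 + g * q := by
    rw [ENNReal.toReal_inv, add_mul, inv_mul_cancel₀ hq.ne']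
  rw [truncPowerNorm_eq_ofReal hNpos hp hp_top, hexp]
  refine ENNReal.ofReal_le_ofReal ((Real.rpow_le_rpow (integral_max_rpow_nonneg hNpos _) hint
    (by positivity)).trans_eq ?_)
  rw [Real.mul_rpow (by positivity) (by positivity), ← Real.rpow_mul hNpos.le,
    mul_inv_cancel_right₀ hq.ne']

lemma exists_truncPowerNorm_le (hσ : 0 ≤ σ) (hσp : σ < p⁻¹.toReal) :
    ∃ B : ℝ, 0 < B ∧ ∀ N : ℝ, 1 ≤ N → truncPowerNorm σ p N ≤ ENNReal.ofReal B := by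
  have hinv : 0 < p⁻¹.toReal := hσ.trans_lt hσp
  obtain ⟨hp_top, hp⟩ : p ≠ ⊤ ∧ p ≠ 0 := by
    constructor <;> rintro rfl <;> simp at hinv
  set q : ℝ := p.toReal
  have hq : 0 < q := ENNReal.toReal_pos hp hp_top
  have hσq : σ * q < 1 := by
    rwa [← lt_div_iff₀ hq, one_div, ← ENNReal.toReal_inv]
  refine ⟨((1 - σ * q)⁻¹) ^ q⁻¹, Real.rpow_pos_of_pos (inv_pos.2 (sub_pos.2 hσq)) _,
    fun N hN => ?_⟩
  have hNpos : 0 < N := zero_lt_one.trans_le hN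
  have hint : ∫ x in 0..1, max x N⁻¹ ^ (-(σ * q)) ≤ (1 - σ * q)⁻¹ := by
    rw [integral_max_inv_rpow_neg hN hσq.ne, ← one_div]
    exact div_le_div_of_nonneg_right (sub_le_self _ (by positivity)) (sub_pos.2 hσq).le
  rw [truncPowerNorm_eq_ofReal hNpos hp hp_top]
  exact ENNReal.ofReal_le_ofReal
    (Real.rpow_le_rpow (integral_max_rpow_nonneg hNpos _) hint (by positivity))

end TruncatedPowers

/-! ### Wall coordinates of Haar measures -/

section HaarMeasure

open MeasureTheory Set

variable {E F : Type*} [NormedAddCommGroup E] [NormedSpace ℝ E] [MeasurableSpace E] [BorelSpace E]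
  [FiniteDimensional ℝ E] [NormedAddCommGroup F] [NormedSpace ℝ F] [MeasurableSpace F]
  [BorelSpace F]

lemma exists_map_affineEquiv_eq_smul (e : E ≃ᵃ[ℝ] F) (μ : Measure E) [μ.IsAddHaarMeasure]
    (ν : Measure F) [ν.IsAddHaarMeasure] : ∃ c : NNReal, c ≠ 0 ∧ μ.map e = c • ν := by
  have : FiniteDimensional ℝ F := Module.Finite.equiv e.linear
  let l : E ≃L[ℝ] F := e.linear.toContinuousLinearEquiv
  have : (μ.map l).IsAddHaarMeasure := l.isAddHaarMeasure_map μ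
  have decomp : (e : E → F) = (· + e 0) ∘ l := e.toAffineMap.decomp
  refine ⟨(μ.map l).addHaarScalarFactor ν,
    (Measure.addHaarScalarFactor_pos_of_isAddHaarMeasure _ _).ne', ?_⟩
  rw [← Measure.isAddLeftInvariant_eq_smul, decomp,
    ← Measure.map_map (measurable_add_const _) l.continuous.measurable, map_add_right_eq_self]

end HaarMeasure

section HaarWallCoordinates

open MeasureTheory Set

variable {ι M 𝔱 : Type*} [AddCommGroup M] [Module ℝ M]

lemma eq_of_forall_ne_wallCoord_eq [AddCommGroup 𝔱] [Module ℝ 𝔱] {P : RootPairing ι ℝ M 𝔱}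
    [P.IsRootSystem] {b : P.Base} {θ : ι} (hθ : IsHighestRoot b θ) {i : Option b.support}
    {H H' : 𝔱} (h : ∀ j ≠ i, wallCoord b θ j H = wallCoord b θ j H') : H = H' := by
  classical
  have hi : wallCoord b θ i H = wallCoord b θ i H' := by
    have hsum := (sum_mark_mul_wallCoord b θ H).trans (sum_mark_mul_wallCoord b θ H').symm
    rw [← Finset.sum_erase_add _ _ (Finset.mem_univ i), ← Finset.sum_erase_add _ _
      (Finset.mem_univ i), Finset.sum_congr rfl fun j hj => by rw [h j (Finset.ne_of_mem_erase hj)],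
      add_right_inj] at hsum
    exact mul_left_cancel₀ (zero_lt_one.trans_le (one_le_mark hθ i)).ne' hsum
  have hall (j) : wallCoord b θ j H = wallCoord b θ j H' := by
    rcases eq_or_ne j i with rfl | hj
    exacts [hi, h j hj]
  have hflip : P.toLinearMap.flip H = P.toLinearMap.flip H' := by
    refine b.toWeightBasis.ext fun j => ?_
    have := toLinearMap_extRoot_apply b θ (some j) H
    rw [hall, ← toLinearMap_extRoot_apply] at this
    simpa [extRoot] using this
  exact P.flip.toPerfPair.injective (by simpa using hflip)

lemma exists_mem_iff_ne [AddCommGroup 𝔱] [Module ℝ 𝔱] {P : RootPairing ι ℝ M 𝔱}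
    {b : P.Base} {I : Finset (Option b.support)} (hI : I.card = b.support.card) :
    ∃ i, ∀ j, j ∈ I ↔ j ≠ i := by
  classical
  obtain ⟨i, hi⟩ := Finset.card_eq_one.1 (show Iᶜ.card = 1 by simp [Finset.card_compl, hI])
  exact ⟨i, fun j => (not_iff_comm.1 (by simpa using Finset.ext_iff.1 hi j)).symm⟩

lemma piece_subset_preimage_Ioc [AddCommGroup 𝔱] [Module ℝ 𝔱] {P : RootPairing ι ℝ M 𝔱}
    [P.IsRootSystem] {b : P.Base} {θ : ι} (hθ : IsHighestRoot b θ)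
    (I J : Finset (Option b.support)) (N : ℝ) :
    piece b θ N I J ⊆ (fun H (j : I) => wallCoord b θ j H) ⁻¹' univ.pi fun _ => Ioc 0 1 :=
  fun _ hH j _ => ⟨hH.1.1 j, wallCoord_le_one_of_mem_alcove hθ hH.1.1 j⟩

variable [NormedAddCommGroup 𝔱] [NormedSpace ℝ 𝔱] [FiniteDimensional ℝ 𝔱] [MeasurableSpace 𝔱]
  [BorelSpace 𝔱] {P : RootPairing ι ℝ M 𝔱}

lemma measurable_wallCoord (b : P.Base) (θ : ι) (j : Option b.support) :
    Measurable (wallCoord b θ j) := by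
  rw [← coe_wallAffine]
  exact (AffineMap.continuous_of_finiteDimensional _).measurable

lemma measurable_weight [Fintype ι] (b : P.Base) (θ : ι) (I J : Finset (Option b.support)) :
    Measurable (weight b θ I J) := by
  have (k : ι) : Continuous (P.toLinearMap (P.root k)) :=
    LinearMap.continuous_of_finiteDimensional _
  unfold weight rootValue
  fun_prop

lemma exists_map_wallCoord_eq_smul [P.IsRootSystem] {b : P.Base} {θ : ι} (hθ : IsHighestRoot b θ)
    {I : Finset (Option b.support)} (hI : I.card = b.support.card) (μ : Measure 𝔱)
    [μ.IsAddHaarMeasure] :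
    ∃ c : NNReal, c ≠ 0 ∧ μ.map (fun H (j : I) => wallCoord b θ j H) = c • volume := by
  obtain ⟨i, hi⟩ := exists_mem_iff_ne hI
  let T : 𝔱 →ᵃ[ℝ] I → ℝ := AffineMap.pi fun j => wallAffine b θ j
  have hT : ⇑T = fun H (j : I) => wallCoord b θ j H := by
    funext H j
    simp [T, ← coe_wallAffine]
  have injective : Function.Injective T := fun H H' h =>
    eq_of_forall_ne_wallCoord_eq hθ fun j hj => by
      simpa [hT] using congrFun h ⟨j, (hi j).2 hj⟩
  have finrank_eq : Module.finrank ℝ 𝔱 = Module.finrank ℝ (I → ℝ) := by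
    simp [Module.finrank_eq_card_basis b.toCoweightBasis, hI]
  have bijective : Function.Bijective T := by
    rw [← AffineMap.linear_bijective_iff]
    have := T.linear_injective_iff.2 injective
    exact ⟨this, (LinearMap.injective_iff_surjective_of_finrank_eq_finrank finrank_eq).1 this⟩
  rw [← hT]
  exact exists_map_affineEquiv_eq_smul (AffineEquiv.ofBijective bijective) μ volume

end HaarWallCoordinates

/-! ### The norm estimate -/

section NormEstimate

open MeasureTheory Set

variable {ι M 𝔱 : Type*} [AddCommGroup M] [Module ℝ M] [NormedAddCommGroup 𝔱] [NormedSpace ℝ 𝔱]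
  [FiniteDimensional ℝ 𝔱] [MeasurableSpace 𝔱] [BorelSpace 𝔱] {P : RootPairing ι ℝ M 𝔱}
  [P.IsRootSystem] [Fintype ι] [P.IsIrreducible] {b : P.Base} {θ : ι}
  {I J : Finset (Option b.support)}

lemma exists_ae_norm_one_div_weight_le (hθ : IsHighestRoot b θ) {i : Option b.support} (hi : i ∉ I)
    (hJ : J ⊆ I) (μ : Measure 𝔱) :
    ∃ D : ℝ, 0 < D ∧ ∀ N : ℝ, 1 ≤ N → ∀ᵐ H ∂μ.restrict (piece b θ N I J),
      ‖1 / weight b θ I J H‖ ≤ D * N ^ (-(subPosRoots b θ J).card : ℝ) *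
        ∏ j ∈ I, max (wallCoord b θ j H) N⁻¹ ^ (-((posRoots b).card / b.support.card : ℝ)) := by
  have := measurable_weight b θ I J
  have := measurable_wallCoord b θ
  refine ⟨((4 * (Fintype.card (Option b.support) : ℝ)⁻¹) ^
    ((subPosRoots b θ I).card - (subPosRoots b θ J).card))⁻¹, by positivity, fun N hN => ?_⟩
  rw [ae_restrict_iff (measurableSet_le (by fun_prop) (by fun_prop)),
    Real.rpow_neg (zero_le_one.trans hN), Real.rpow_natCast, ← mul_inv]
  exact Filter.Eventually.of_forall fun H hH => norm_one_div_weight_le hθ hi hJ hN hH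

lemma exists_invWeightNorm_le_mul_truncPowerNorm_pow (hθ : IsHighestRoot b θ)
    (hI : I.card = b.support.card) (hJ : J ⊆ I) (μ : Measure 𝔱) [μ.IsAddHaarMeasure] (p : ℝ≥0∞) :
    ∃ C : ℝ, 0 < C ∧ ∀ N : ℝ, 1 ≤ N → invWeightNorm b θ μ p N I J ≤
      ENNReal.ofReal (C * N ^ (-(subPosRoots b θ J).card : ℝ)) *
        truncPowerNorm ((posRoots b).card / b.support.card) p N ^ b.support.card := by
  obtain ⟨i, hi⟩ := exists_mem_iff_ne hI
  obtain ⟨c, hc, hmap⟩ := exists_map_wallCoord_eq_smul hθ hI μ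
  obtain ⟨D, hD, hweight⟩ :=
    exists_ae_norm_one_div_weight_le hθ (fun h => (hi i).1 h rfl) hJ μ
  have hT : Measurable fun H (j : I) => wallCoord b θ j H :=
    measurable_pi_lambda _ fun j => measurable_wallCoord b θ j
  set ρ : ℝ := (posRoots b).card / b.support.card
  have : 0 < c := pos_iff_ne_zero.2 hc
  refine ⟨D * (c ^ p.toReal⁻¹ : NNReal), by positivity, fun N hN => ?_⟩
  have hNpos : 0 < N := zero_lt_one.trans_le hN
  set δ : ℝ := N ^ (-(subPosRoots b θ J).card : ℝ)
  have : 0 < δ := by positivity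
  set f : 𝔱 → ℝ := fun H => ∏ j : I, max (wallCoord b θ j H) N⁻¹ ^ (-ρ)
  have : IsProbabilityMeasure (volume.restrict (Ioc (0 : ℝ) 1)) := ⟨by simp⟩
  have hf : eLpNorm f p (μ.restrict (piece b θ N I J)) ≤
      (c ^ p.toReal⁻¹ : NNReal) * truncPowerNorm ρ p N ^ Fintype.card I :=
    (eLpNorm_mono_measure _ (Measure.restrict_mono (piece_subset_preimage_Ioc hθ I J N)
      le_rfl)).trans (eLpNorm_prod_comp_le hT hc hmap
        (continuous_max_rpow (inv_pos.2 hNpos) (-ρ)).stronglyMeasurable measurableSet_Ioc p)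
  have le_mul_f : ∀ᵐ H ∂μ.restrict (piece b θ N I J),
      ‖1 / weight b θ I J H‖ ≤ ‖(D * δ) • f H‖ := by
    filter_upwards [hweight N hN] with H hH
    rw [← Finset.prod_coe_sort] at hH
    exact hH.trans (le_abs_self _)
  calc invWeightNorm b θ μ p N I J
      ≤ ‖D * δ‖ₑ * eLpNorm f p (μ.restrict (piece b θ N I J)) :=
        (eLpNorm_mono_ae le_mul_f).trans_eq (eLpNorm_const_smul (D * δ) f p _)
    _ ≤ ‖D * δ‖ₑ * ((c ^ p.toReal⁻¹ : NNReal) * truncPowerNorm ρ p N ^ Fintype.card I) := by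
        gcongr
    _ = _ := by
        rw [Fintype.card_coe, hI, ← mul_assoc, Real.enorm_of_nonneg (by positivity),
          ← ENNReal.ofReal_coe_nnreal, ← ENNReal.ofReal_mul (by positivity), mul_right_comm]

lemma exists_invWeightNorm_le_rpow (hθ : IsHighestRoot b θ) (hI : I.card = b.support.card)
    (hJ : J ⊆ I) (μ : Measure 𝔱) [μ.IsAddHaarMeasure] {p : ℝ≥0∞} {g : ℝ}
    (hg : ∃ B : ℝ, 0 < B ∧ ∀ N : ℝ, 1 ≤ N →
      truncPowerNorm ((posRoots b).card / b.support.card) p N ≤ ENNReal.ofReal (B * N ^ g)) :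
    ∃ C : ℝ, 0 < C ∧ ∀ N : ℝ, 1 ≤ N → invWeightNorm b θ μ p N I J ≤
      ENNReal.ofReal (C * N ^ (b.support.card * g - (subPosRoots b θ J).card)) := by
  obtain ⟨B, hB, hnorm⟩ := hg
  obtain ⟨C, hC, hle⟩ := exists_invWeightNorm_le_mul_truncPowerNorm_pow hθ hI hJ μ p
  refine ⟨C * B ^ b.support.card, by positivity, fun N hN => ?_⟩
  have hNpos : 0 < N := zero_lt_one.trans_le hN
  calc invWeightNorm b θ μ p N I J
      ≤ ENNReal.ofReal (C * N ^ (-(subPosRoots b θ J).card : ℝ)) *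
          ENNReal.ofReal (B * N ^ g) ^ b.support.card :=
        (hle N hN).trans (by gcongr; exact hnorm N hN)
    _ = _ := by
        rw [← ENNReal.ofReal_pow (by positivity), ← ENNReal.ofReal_mul (by positivity),
          sub_eq_neg_add, Real.rpow_add hNpos, mul_comm (b.support.card : ℝ),
          Real.rpow_mul_natCast hNpos.le]
        ring_nf

end NormEstimate

lemma toReal_inv_natCast_div (m n : ℕ) : ((m / n : ℝ≥0∞)⁻¹).toReal = n / m := by
  rw [ENNReal.toReal_inv, ENNReal.toReal_div, ENNReal.toReal_natCast, ENNReal.toReal_natCast,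
    inv_div]

lemma toReal_inv_lt_div_of_div_lt {m n : ℕ} (hm : m ≠ 0) {p : ℝ≥0∞} (h : (m / n : ℝ≥0∞) < p) :
    p⁻¹.toReal < n / m := by
  rw [← toReal_inv_natCast_div]
  exact ENNReal.toReal_strict_mono (ENNReal.inv_ne_top.2 (by simp [hm])) (ENNReal.inv_lt_inv.2 h)

lemma div_lt_toReal_inv_of_lt_div {m n : ℕ} {p : ℝ≥0∞} (hp : p ≠ 0) (h : p < (m / n : ℝ≥0∞)) :
    n / m < p⁻¹.toReal := by
  rw [← toReal_inv_natCast_div]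
  exact ENNReal.toReal_strict_mono (ENNReal.inv_ne_top.2 hp) (ENNReal.inv_lt_inv.2 h)

end WeylAlcove

theorem mainTheorem6 {ι M 𝔱 : Type*} [Fintype ι] [AddCommGroup M] [Module ℝ M]
    [NormedAddCommGroup 𝔱] [NormedSpace ℝ 𝔱] [FiniteDimensional ℝ 𝔱]
    [MeasurableSpace 𝔱] [BorelSpace 𝔱]
    (μ : MeasureTheory.Measure 𝔱) [μ.IsAddHaarMeasure]
    (P : RootPairing ι ℝ M 𝔱) [P.IsRootSystem] [P.IsCrystallographic] [P.IsReduced]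
    [P.IsIrreducible]
    (b : P.Base) (θ : ι) (hθ : WeylAlcove.IsHighestRoot b θ)
    (I J : Finset (Option b.support)) (hI : I.card = b.support.card) (hJ : J ⊆ I)
    (p : ℝ≥0∞) (hp : 0 < p) :
    ((b.support.card : ℝ≥0∞) / ((WeylAlcove.posRoots b).card : ℝ≥0∞) < p →
      ∃ C : ℝ, 0 < C ∧ ∀ N : ℝ, 1 ≤ N →
        WeylAlcove.invWeightNorm b θ μ p N I J ≤
          ENNReal.ofReal (C * N ^ (((WeylAlcove.posRoots b).card : ℝ)
            - ((WeylAlcove.subPosRoots b θ J).card : ℝ)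
            - ((b.support.card : ℝ≥0∞) / p).toReal))) ∧
    (p = (b.support.card : ℝ≥0∞) / ((WeylAlcove.posRoots b).card : ℝ≥0∞) →
      ∀ ε : ℝ, 0 < ε → ∃ C : ℝ, 0 < C ∧ ∀ N : ℝ, 1 ≤ N →
        WeylAlcove.invWeightNorm b θ μ p N I J ≤
          ENNReal.ofReal (C * N ^ (-((WeylAlcove.subPosRoots b θ J).card : ℝ) + ε))) ∧
    (p < (b.support.card : ℝ≥0∞) / ((WeylAlcove.posRoots b).card : ℝ≥0∞) →
      ∃ C : ℝ, 0 < C ∧ ∀ N : ℝ, 1 ≤ N →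
        WeylAlcove.invWeightNorm b θ μ p N I J ≤
          ENNReal.ofReal (C * N ^ (-((WeylAlcove.subPosRoots b θ J).card : ℝ)))) := by
  have : Nonempty ι := ⟨θ⟩
  have hr : b.support.card ≠ 0 := (Finset.card_pos.2 b.support_nonempty).ne'
  have hr' : (b.support.card : ℝ) ≠ 0 := Nat.cast_ne_zero.2 hr
  refine ⟨fun h => ?_, fun h ε hε => ?_, fun h => ?_⟩
  · have hσ := WeylAlcove.toReal_inv_lt_div_of_div_lt hr h
    convert WeylAlcove.exists_invWeightNorm_le_rpow hθ hI hJ μ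
      (WeylAlcove.exists_truncPowerNorm_le_rpow hp.ne' (sub_pos.2 hσ) (by simp)) using 6
    rw [ENNReal.toReal_div, ENNReal.toReal_inv, ENNReal.toReal_natCast, mul_sub,
      mul_div_cancel₀ _ hr', div_eq_mul_inv, sub_right_comm]
  · have hg : 0 < ε / b.support.card := by positivity
    convert WeylAlcove.exists_invWeightNorm_le_rpow hθ hI hJ μ
      (WeylAlcove.exists_truncPowerNorm_le_rpow hp.ne' hg ?_) using 6
    · rw [mul_div_cancel₀ _ hr', neg_add_eq_sub]
    · rw [h, WeylAlcove.toReal_inv_natCast_div]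
      exact le_add_of_nonneg_right hg.le
  · have hσ := WeylAlcove.div_lt_toReal_inv_of_lt_div hp.ne' h
    simpa using WeylAlcove.exists_invWeightNorm_le_rpow hθ hI hJ μ (g := 0)
      (by simpa using WeylAlcove.exists_truncPowerNorm_le (by positivity) hσ)
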